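/- Let $r\ge 1$ be an integer. Write $|\cdot|_2$ and $|\cdot|_\infty$ for the Euclidean and the maximum norm on $\mathbb{R}^r$, and $\widehat f(\xi)=(2\pi)^{-r/2}\int_{\mathbb{R}^r}e^{iu^\top\xi}f(u)\,du$ for the Fourier transform of an integrable function $f$. For $0<\beta<1$ and $K>0$ let - $\mathcal{C}^\beta_r(K)$ be the Hölder ball of all $h:\mathbb{R}^r\to[-1,1]$ with $2^\beta|h(x)-h(y)|\le K|x-y|_\infty^\beta$ for all $x,y\in\mathbb{R}^r$; - $\mathcal{W}^\beta_r(K)$ be the Sobolev ball of all integrable $h:\mathbb{R}^r\to\mathbb{R}$ with $\int_{\mathbb{R}^r}|\widehat h(\xi)|^2(1+|\xi|_2)^{2\beta}\,\frac{d\xi}{(2\pi)^{r/2}}\le K^2$. (A function $h$ on the cube $[-1,1]^r$ is thus identified with an extension to $\mathbb{R}^r$ that lies in both balls; the convolution $h*\phi_\sigma$ is taken over $\mathbb{R}^r$.) Call a real-valued integrable function $\phi$ on $\mathbb{R}^r$ a regular kernel for $\beta$ if $\int\phi=1$, $\int|v|_\infty^\beta|\phi(v)|\,dv<\infty$, $\int|\widehat\phi(\xi)|^2\,d\xi<\infty$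 and $\sup_{\xi}|\widehat\phi(\xi)|^2|\xi|_2^r<\infty$; put $\phi_\sigma=\sigma^{-r}\phi(\cdot/\sigma)$. Let $X^\beta=(X^\beta(u))_{u\in[-1,1]^r}$ be a Lévy fractional Brownian motion of order $\beta$, that is, a centered Gaussian process with $X^\beta(0)=0$ almost surely and $\mathbb{E}|X^\beta(u)-X^\beta(u')|^2=|u-u'|_2^{2\beta}$ for all $u,u'\in[-1,1]^r$, and let $Z\sim\mathcal{N}(0,1)$ be independent of $X^\beta$. Let $\mathbb{H}$ be the reproducing kernel Hilbert space on $[-1,1]^r$ generated by the covariance function of the process $Z+X^\beta$ (fractional Brownian motion released at zero). **Lemma.** There is a function $\phi$ on $\mathbb{R}^r$ that is a regular kernel for every $\beta\in(0,1)$. Moreover, for every $\beta\in(0,1)$ and every regular kernel $\phi$ for $\beta$ there are constants $R_\beta,L_\beta>0$, depending only on $\beta$, $r$ and the chosen kernel $\phi$, such that for all $K>0$, all $h\in\mathcal{C}^\beta_r(K)\cap\mathcal{W}^\beta_r(K)$ and all $0<\sigma<1$, $$\|h*\phi_\sigma-h\|_\infty\le K R_\beta\,\sigma^\beta$$ (supremum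 over $\mathbb{R}^r$, in particular over $[-1,1]^r$), and the restriction of $h*\phi_\sigma$ to $[-1,1]^r$ belongs to $\mathbb{H}$ with $$\|h*\phi_\sigma\|_{\mathbb{H}}^2\le K^2L_\beta^2\,\sigma^{-r}.$$ -/

import Mathlib

open MeasureTheory ProbabilityTheory
open scoped RealInnerProductSpace Convolution

noncomputable section

namespace LevyFBM

/-- The Euclidean space `ℝ^r`; its norm `‖·‖` is the Euclidean norm. -/
abbrev E (r : ℕ) : Type := EuclideanSpace ℝ (Fin r)

/-- The maximum norm `|x|_∞` of a vector of `ℝ^r`. -/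
def supNorm {r : ℕ} (x : E r) : ℝ := ‖(WithLp.ofLp x : Fin r → ℝ)‖

/-- The cube `[-1, 1]^r`. -/
def cube (r : ℕ) : Set (E r) := {u | ∀ i, u i ∈ Set.Icc (-1 : ℝ) 1}

/-- The origin as a point of the cube. -/
def cubeZero (r : ℕ) : cube r := ⟨0, fun i => by simp⟩

/-- The Fourier transform `f̂(ξ) = (2π)^{-r/2} ∫ e^{i uᵀξ} f(u) du`. -/
def fourierHat {r : ℕ} (f : E r → ℝ) (ξ : E r) : ℂ :=
  (((2 * Real.pi) ^ (-(r : ℝ) / 2) : ℝ) : ℂ) *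
    ∫ u : E r, Complex.exp (Complex.I * ((⟪u, ξ⟫ : ℝ) : ℂ)) * (f u : ℂ)

/-- The Hölder ball of radius `K` of functions `ℝ^r → [-1, 1]`, for a smoothness index
`0 < β < 1`. As `⌊β⌋ = 0`, the Hölder norm is the single term
`2^β sup_{x ≠ y} |h x - h y| / |x - y|_∞^β`. -/
structure MemHolderBall {r : ℕ} (β K : ℝ) (h : E r → ℝ) : Prop where
  mem_Icc : ∀ x, h x ∈ Set.Icc (-1 : ℝ) 1
  holder : ∀ x y, 2 ^ β * |h x - h y| ≤ K * supNorm (x - y) ^ β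

/-- The `β`-Sobolev ball of radius `K`: integrable functions `h` for which
`ξ ↦ (1 + |ξ|₂)^β ĥ(ξ)` has norm at most `K` in `L²(dξ / (2π)^{r/2})`. -/
structure MemSobolevBall {r : ℕ} (β K : ℝ) (h : E r → ℝ) : Prop where
  integrable : Integrable h
  integrable_sq : Integrable fun ξ : E r => ‖fourierHat h ξ‖ ^ 2 * (1 + ‖ξ‖) ^ (2 * β)
  integral_le : (2 * Real.pi) ^ (-(r : ℝ) / 2) *
    ∫ ξ : E r, ‖fourierHat h ξ‖ ^ 2 * (1 + ‖ξ‖) ^ (2 * β) ≤ K ^ 2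

/-- Regular convolution kernels for the smoothness index `β`. -/
structure IsRegularKernel {r : ℕ} (β : ℝ) (φ : E r → ℝ) : Prop where
  integrable : Integrable φ
  integral_eq_one : ∫ v, φ v = 1
  moment : Integrable fun v : E r => supNorm v ^ β * φ v
  fourier_sq : Integrable fun ξ : E r => ‖fourierHat φ ξ‖ ^ 2
  fourier_decay : BddAbove (Set.range fun ξ : E r => ‖fourierHat φ ξ‖ ^ 2 * ‖ξ‖ ^ r)

/-- The rescaled kernel `φ_σ = σ^{-r} φ(·/σ)`. -/
def rescale {r : ℕ} (σ : ℝ) (φ : E r → ℝ) (v : E r) : ℝ := (σ ^ r)⁻¹ * φ (σ⁻¹ • v)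

/-- The convolution `(h * φ_σ)(u) = ∫ h(v) φ_σ(u - v) dv` over `ℝ^r`. -/
def smooth {r : ℕ} (h φ : E r → ℝ) (σ : ℝ) : E r → ℝ :=
  h ⋆[ContinuousLinearMap.mul ℝ ℝ, volume] rescale σ φ

section FBM

variable {Ω : Type*} [MeasurableSpace Ω]

/-- Lévy fractional Brownian motion of order `β` on `[-1, 1]^r`: a centered Gaussian process
that vanishes at the origin and has `𝔼 |X u - X v|² = |u - v|₂^{2β}`. -/
structure IsLevyFBM {r : ℕ} (β : ℝ) (X : cube r → Ω → ℝ) (P : Measure Ω) : Prop where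
  gaussian : IsGaussianProcess X P
  centered : ∀ u, ∫ ω, X u ω ∂P = 0
  zero : ∀ᵐ ω ∂P, X (cubeZero r) ω = 0
  increments : ∀ u v, ∫ ω, |X u ω - X v ω| ^ 2 ∂P = ‖(u : E r) - (v : E r)‖ ^ (2 * β)

/-- The process `u ↦ Z + X u`. -/
def releasedAtZero {r : ℕ} (Z : Ω → ℝ) (X : cube r → Ω → ℝ) (u : cube r) (ω : Ω) : ℝ :=
  Z ω + X u ω

/-- The covariance function `k(s, t) = 𝔼[Y s * Y t]` of a centered process, in the form in which
Mathlib's reproducing kernel Hilbert spaces expect a kernel: the operator `x ↦ k(s, t) x` on `ℝ`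
stands for the number `k(s, t)`. -/
def covKernel {T : Type*} (Y : T → Ω → ℝ) (P : Measure Ω) : Matrix T T (ℝ →L[ℝ] ℝ) :=
  Matrix.of fun s t => (∫ ω, Y s ω * Y t ω ∂P) • ContinuousLinearMap.id ℝ ℝ

theorem covKernel_posSemidef {T : Type*} {Y : T → Ω → ℝ} {P : Measure Ω}
    (hY : ∀ t, MemLp (Y t) 2 P) : (covKernel Y P).PosSemidef := by
  have hint : ∀ s t, Integrable (fun ω => Y s ω * Y t ω) P := fun s t =>
    (hY s).integrable_mul (hY t)
  have tfae := (RKHS.posSemidef_tfae (K := covKernel Y P)).out 0 2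
  refine tfae.mpr ⟨?_, ?_⟩
  · ext s t
    simp [covKernel, Matrix.conjTranspose_apply, mul_comm, ContinuousLinearMap.star_eq_adjoint,
      ContinuousLinearMap.adjoint_id]
  · intro v
    have key : (v.sum fun x w => v.sum fun x' w' => ⟪covKernel Y P x' x w, w'⟫)
        = ∫ ω, (v.sum fun x w => w * Y x ω) ^ 2 ∂P := by
      simp only [Finsupp.sum, sq, Finset.sum_mul_sum]
      rw [integral_finsetSum]
      · refine Finset.sum_congr rfl fun x _ => ?_
        rw [integral_finsetSum]
        · refine Finset.sum_congr rfl fun y _ => ?_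
          have : (fun ω => v x * Y x ω * (v y * Y y ω))
              = fun ω => (v x * v y) * (Y y ω * Y x ω) := by
            funext ω; ring
          rw [this, integral_const_mul]
          simp [covKernel]
          ring
        · intro y _
          have := (hint x y).const_mul (v x * v y)
          refine this.congr (Filter.Eventually.of_forall fun ω => ?_)
          simp only []
          ring
      · intro x _
        refine integrable_finsetSum _ fun y _ => ?_
        have := (hint x y).const_mul (v x * v y)
        refine this.congr (Filter.Eventually.of_forall fun ω => ?_)
        simp only []
        ring
    rw [key]
    exact integral_nonneg fun ω => sq_nonneg _

theorem memLp_releasedAtZero {r : ℕ} {β : ℝ} {Z : Ω → ℝ} {X : cube r → Ω → ℝ} {P : Measure Ω}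
    (hX : IsLevyFBM β X P) (hZ : HasLaw Z (gaussianReal 0 1) P) (u : cube r) :
    MemLp (releasedAtZero Z X u) 2 P := by
  have h1 : MemLp (X u) 2 P := (hX.gaussian.hasGaussianLaw_eval u).memLp_two
  have h2 : MemLp Z 2 P := hZ.hasGaussianLaw.memLp_two
  exact h2.add h1

/-- The covariance function of `Z + X` is a positive semidefinite kernel, so that it generates a
reproducing kernel Hilbert space `RKHS.OfKernel (covKernel (releasedAtZero Z X) P)`. -/
theorem fact_posSemidef {r : ℕ} {β : ℝ} {Z : Ω → ℝ} {X : cube r → Ω → ℝ} {P : Measure Ω}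
    (hX : IsLevyFBM β X P) (hZ : HasLaw Z (gaussianReal 0 1) P) :
    Fact (covKernel (releasedAtZero Z X) P).PosSemidef :=
  ⟨covKernel_posSemidef (memLp_releasedAtZero hX hZ)⟩

end FBM

end LevyFBM

end

/-! Write g = h * φ_σ. Since φ has mass one, g(u) - h(u) averages h(u - σv) - h(u) against φ, and
the Hölder condition with the β-moment of φ gives the uniform bound.

For the norm, g belongs to the space of a kernel k with norm at most M as soon as (∑ c_u g(u))² ≤ M²
∑ c_s c_t k(s,t) for all finite families c. Here k(s,t) = 1 + (|s|^{2β} + |t|^{2β} - |s-t|^{2β})/2,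
and invariance and scaling give C|s|^{2β} = ∫ (1 - cos⟨s,ξ⟩) |ξ|^{-(2β+r)} dξ for some C > 0 whose
value is irrelevant. Hence the quadratic form is (∑ c_u)² + (2C)⁻¹ ∫ |D_c(ξ)|² |ξ|^{-(2β+r)} dξ,
with D_c(ξ) = ∑ c_u (e^{-i⟨u,ξ⟩} - 1).

Fourier inversion gives ∑ c_u g(u) = (∑ c_u) g(0) + ∫ D_c(ξ) ĥ(ξ) φ̂(σξ) dξ. Two uses of
Cauchy–Schwarz show that M² = g(0)² + 2C ∫ |ĥ(ξ) φ̂(σξ)|² |ξ|^{2β+r} dξ suffices. Both terms are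
O(K²σ^{-r}): the first (`sq_integral_norm_fourierHat_mul_le`) because φ̂ is square integrable, the
second (`integral_normSq_fourierHat_mul_le`) because |φ̂(σξ)|² |ξ|^r is O(σ^{-r}), leaving the
Sobolev integral. The Gaussian density is a regular kernel for every β. -/

/-! ### Membership in a reproducing kernel Hilbert space -/

/-- A function on which all finite linear combinations of evaluations are bounded by `M` times the
norm given by the kernel belongs to the reproducing kernel Hilbert space, with norm at most `M`. -/
theorem RKHS.exists_eq_of_sq_sum_le {T H : Type*} [NormedAddCommGroup H] [InnerProductSpace ℝ H]
    [RKHS ℝ H T ℝ] [CompleteSpace H] (g : T → ℝ) {M : ℝ} (hM : 0 ≤ M)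
    (hg : ∀ c : T →₀ ℝ, (c.sum fun t a => a * g t) ^ 2
      ≤ M ^ 2 * c.sum fun s a => c.sum fun t b => a * b * RKHS.kernel H s t 1) :
    ∃ f : H, (∀ t, f t = g t) ∧ ‖f‖ ≤ M := by
  set e : (T →₀ ℝ) →ₗ[ℝ] H := Finsupp.linearCombination ℝ fun t => RKHS.kerFun H t (1 : ℝ) with he
  set b : (T →₀ ℝ) →ₗ[ℝ] ℝ := Finsupp.linearCombination ℝ g with hbdef
  have hdense : DenseRange e := by
    have h1 : (Submodule.span ℝ (Set.range fun t => RKHS.kerFun H t (1 : ℝ)))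
        = Submodule.span ℝ {RKHS.kerFun H x v | (x : T) (v : ℝ)} := by
      apply le_antisymm
      · refine Submodule.span_mono ?_
        rintro _ ⟨t, rfl⟩
        exact ⟨t, 1, rfl⟩
      · refine Submodule.span_le.mpr ?_
        rintro _ ⟨t, v, rfl⟩
        have : RKHS.kerFun H t v = v • RKHS.kerFun H t (1 : ℝ) := by
          rw [← map_smul]; simp
        rw [this]
        exact Submodule.smul_mem _ _ (Submodule.subset_span ⟨t, rfl⟩)
    have h2 : Dense ((LinearMap.range e : Submodule ℝ H) : Set H) := by
      rw [he, Finsupp.range_linearCombination, h1, Submodule.dense_iff_topologicalClosure_eq_top]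
      exact RKHS.kerFun_dense (𝕜 := ℝ) H
    rwa [LinearMap.coe_range] at h2
  have hbound : ∀ c, ‖b c‖ ≤ M * ‖e c‖ := by
    intro c
    have h1 : ‖e c‖ ^ 2 = c.sum fun s a => c.sum fun t b => a * b * RKHS.kernel H s t 1 := by
      rw [← real_inner_self_eq_norm_sq, he, Finsupp.linearCombination_apply, Finsupp.sum_inner]
      simp only [Finsupp.sum, inner_sum, inner_smul_left, inner_smul_right]
      refine Finset.sum_congr rfl fun s _ => Finset.sum_congr rfl fun t _ => ?_
      rw [RKHS.kerFun_inner, RKHS.kerFun_apply]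
      simp
      ring
    refine abs_le_of_sq_le_sq ?_ (by positivity)
    rw [mul_pow, h1]
    simpa [hbdef, Finsupp.linearCombination_apply] using hg c
  -- By `hbound` the functional ∑ c_t k_t ↦ ∑ c_t g(t) is well defined and bounded on a dense
  -- subspace; its extension has a Riesz representative, which takes the values of g by the
  -- reproducing property.
  refine ⟨(InnerProductSpace.toDual ℝ H).symm (b.extendOfNorm e), fun t => ?_, ?_⟩
  · have h1 := RKHS.inner_kerFun (𝕜 := ℝ) t (1 : ℝ)
      ((InnerProductSpace.toDual ℝ H).symm (b.extendOfNorm e))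
    rw [InnerProductSpace.toDual_symm_apply] at h1
    have h2 := LinearMap.extendOfNorm_eq (f := b) hdense ⟨M, hbound⟩ (Finsupp.single t 1)
    simp only [he, hbdef, Finsupp.linearCombination_single, one_smul] at h2
    rw [← he, ← hbdef] at h2
    rw [h2] at h1
    simpa using h1.symm
  · rw [LinearIsometryEquiv.norm_map]
    exact LinearMap.opNorm_extendOfNorm_le hdense hM hbound

namespace LevyFBM

/-! ### Spectral representation of the variogram -/

/-- The spectral density `‖ξ‖^{-(2β+r)}` of fractional Brownian motion, up to a constant. -/
noncomputable def spectralWeight (r : ℕ) (β : ℝ) (ξ : E r) : ℝ := ‖ξ‖ ^ (-(2 * β + r))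

/-- The integral of `1 - cos ⟪s, ξ⟫` against the spectral density. -/
noncomputable def spectralVariogram (r : ℕ) (β : ℝ) (s : E r) : ℝ :=
  ∫ ξ : E r, (1 - Real.cos ⟪s, ξ⟫) * spectralWeight r β ξ

theorem spectralWeight_nonneg (r : ℕ) (β : ℝ) (ξ : E r) : 0 ≤ spectralWeight r β ξ := by
  unfold spectralWeight; positivity

theorem measurable_spectralWeight (r : ℕ) (β : ℝ) : Measurable (spectralWeight r β) := by
  unfold spectralWeight; fun_prop

/-- Near 0 the exponent is 1 - 2β > -1 because β < 1; at infinity it is -2β - 1 < -1 because β > 0.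
-/
theorem integrableOn_min_sq_mul_rpow {β : ℝ} (h0 : 0 < β) (h1 : β < 1) :
    IntegrableOn (fun y : ℝ => min 2 (y ^ 2) * y ^ (-(2 * β) - 1)) (Set.Ioi 0) := by
  have hm : Measurable fun y : ℝ => min 2 (y ^ 2) * y ^ (-(2 * β) - 1) := by fun_prop
  rw [← Set.Ioc_union_Ioi_eq_Ioi zero_le_one]
  refine IntegrableOn.union ?_ ?_
  · have h : IntegrableOn (fun y : ℝ => y ^ (1 - 2 * β)) (Set.Ioc 0 1) := by
      rw [← intervalIntegrable_iff_integrableOn_Ioc_of_le zero_le_one]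
      exact intervalIntegral.intervalIntegrable_rpow' (by linarith)
    refine Integrable.mono' h hm.aestronglyMeasurable ?_
    filter_upwards [ae_restrict_mem measurableSet_Ioc] with y hy
    have hy0 : 0 < y := hy.1
    rw [Real.norm_of_nonneg (by positivity)]
    calc min 2 (y ^ 2) * y ^ (-(2 * β) - 1) ≤ y ^ 2 * y ^ (-(2 * β) - 1) := by
          gcongr; exact min_le_right _ _
      _ = y ^ (1 - 2 * β) := by
          rw [← Real.rpow_natCast, ← Real.rpow_add hy0]; congr 1; push_cast; ring
  · have h : IntegrableOn (fun y : ℝ => 2 * y ^ (-(2 * β) - 1)) (Set.Ioi 1) :=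
      (integrableOn_Ioi_rpow_of_lt (by linarith) one_pos).const_mul 2
    refine Integrable.mono' h hm.aestronglyMeasurable ?_
    filter_upwards [ae_restrict_mem measurableSet_Ioi] with y hy
    have hy0 : 0 < y := one_pos.trans hy
    rw [Real.norm_of_nonneg (by positivity)]
    gcongr; exact min_le_left _ _

variable {r : ℕ} {β : ℝ}

/-- In polar coordinates the volume factor y^{r-1} turns the weight into y^{-2β-1}. -/
theorem integrable_min_sq_mul_spectralWeight (hr : 1 ≤ r) (h0 : 0 < β) (h1 : β < 1) :
    Integrable fun ξ : E r => min 2 (‖ξ‖ ^ 2) * spectralWeight r β ξ := by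
  have : Nonempty (Fin r) := ⟨⟨0, hr⟩⟩
  have := (integrable_fun_norm_addHaar (volume : Measure (E r))
    (f := fun y : ℝ => min 2 (y ^ 2) * y ^ (-(2 * β + r)))).mpr ?_
  · exact this
  refine (integrableOn_min_sq_mul_rpow h0 h1).congr_fun (fun y hy => ?_) measurableSet_Ioi
  have hy0 : (0 : ℝ) < y := hy
  simp only [finrank_euclideanSpace, Fintype.card_fin, smul_eq_mul]
  rw [mul_left_comm, ← Real.rpow_natCast y (r - 1), ← Real.rpow_add hy0, Nat.cast_sub hr]
  congr 2
  push_cast; ring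

/-- Dominated convergence of the integral comes from 1 - cos⟨s,ξ⟩ being at most 2 and at most
‖s‖²‖ξ‖². -/
theorem integrable_one_sub_cos_mul_spectralWeight (hr : 1 ≤ r) (h0 : 0 < β) (h1 : β < 1)
    (s : E r) : Integrable fun ξ : E r => (1 - Real.cos ⟪s, ξ⟫) * spectralWeight r β ξ := by
  refine ((integrable_min_sq_mul_spectralWeight hr h0 h1).const_mul (1 + ‖s‖ ^ 2)).mono'
    (Measurable.aestronglyMeasurable ?_) (Filter.Eventually.of_forall fun ξ => ?_)
  · have := measurable_spectralWeight r β
    fun_prop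
  have hw := spectralWeight_nonneg r β ξ
  have hc := Real.cos_le_one ⟪s, ξ⟫
  rw [Real.norm_of_nonneg (mul_nonneg (by linarith) hw), ← mul_assoc]
  gcongr
  have h2 : 1 - Real.cos ⟪s, ξ⟫ ≤ 2 := by linarith [Real.neg_one_le_cos ⟪s, ξ⟫]
  have h3 : 1 - Real.cos ⟪s, ξ⟫ ≤ ‖s‖ ^ 2 * ‖ξ‖ ^ 2 := by
    have h4 := Real.one_sub_sq_div_two_le_cos (x := ⟪s, ξ⟫)
    have h5 : ⟪s, ξ⟫ ^ 2 ≤ (‖s‖ * ‖ξ‖) ^ 2 := sq_le_sq.mpr (by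
      rw [abs_of_nonneg (by positivity : 0 ≤ ‖s‖ * ‖ξ‖)]; exact abs_real_inner_le_norm s ξ)
    nlinarith [sq_nonneg ⟪s, ξ⟫]
  rcases le_total 2 (‖ξ‖ ^ 2) with h | h
  · rw [min_eq_left h]; nlinarith [sq_nonneg ‖s‖]
  · rw [min_eq_right h]; nlinarith [sq_nonneg ‖ξ‖]

theorem spectralVariogram_linearIsometryEquiv (A : E r ≃ₗᵢ[ℝ] E r) (s : E r) :
    spectralVariogram r β (A s) = spectralVariogram r β s := by
  unfold spectralVariogram
  rw [← A.measurePreserving.integral_comp A.toHomeomorph.measurableEmbedding]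
  simp [spectralWeight, A.inner_map_map]

/-- Under η = aξ the Jacobian a^{-r} and the factor a^{2β+r} from the weight combine to a^{2β}. -/
theorem spectralVariogram_smul {a : ℝ} (ha : 0 < a) (s : E r) :
    spectralVariogram r β (a • s) = a ^ (2 * β) * spectralVariogram r β s := by
  unfold spectralVariogram
  have h := Measure.integral_comp_smul (volume : Measure (E r))
    (fun ξ => (1 - Real.cos ⟪s, ξ⟫) * spectralWeight r β ξ) a
  rw [finrank_euclideanSpace, Fintype.card_fin, abs_of_pos (by positivity), smul_eq_mul,
    eq_comm, inv_mul_eq_iff_eq_mul₀ (by positivity), ← integral_const_mul] at h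
  rw [h, ← integral_const_mul]
  refine integral_congr_ae (Filter.Eventually.of_forall fun ξ => ?_)
  simp only [spectralWeight, real_inner_smul_left, real_inner_smul_right, norm_smul,
    Real.norm_of_nonneg ha.le]
  rw [Real.mul_rpow ha.le (norm_nonneg _)]
  have : a ^ (2 * β) * (a ^ r * a ^ (-(2 * β + r))) = 1 := by
    rw [← Real.rpow_natCast, ← Real.rpow_add ha, ← Real.rpow_add ha, ← Real.rpow_zero a]
    congr 1; ring
  linear_combination (-(1 - Real.cos (a * ⟪s, ξ⟫)) * ‖ξ‖ ^ (-(2 * β + r))) * this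

theorem spectralVariogram_pos (hr : 1 ≤ r) (h0 : 0 < β) (h1 : β < 1) {s : E r} (hs : ‖s‖ = 1) :
    0 < spectralVariogram r β s := by
  unfold spectralVariogram
  have hnn : ∀ ξ : E r, 0 ≤ (1 - Real.cos ⟪s, ξ⟫) * spectralWeight r β ξ := fun ξ =>
    mul_nonneg (by linarith [Real.cos_le_one ⟪s, ξ⟫]) (spectralWeight_nonneg r β ξ)
  rw [integral_pos_iff_support_of_nonneg hnn
    (integrable_one_sub_cos_mul_spectralWeight hr h0 h1 s)]
  -- On this open set, which contains s, the cosine is not 1 and ξ ≠ 0, so the integrand is nonzero.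
  have hopen : IsOpen {ξ : E r | ⟪s, ξ⟫ ∈ Set.Ioo 0 (2 * Real.pi)} :=
    isOpen_Ioo.preimage (by fun_prop)
  refine (hopen.measure_pos volume ⟨s, ?_⟩).trans_le (measure_mono fun ξ hξ => ?_)
  · simp only [Set.mem_ofPred_eq, real_inner_self_eq_norm_sq, hs, Set.mem_Ioo]
    constructor <;> nlinarith [Real.pi_gt_three]
  · have hne : ξ ≠ 0 := by rintro rfl; simp at hξ
    have hcos : Real.cos ⟪s, ξ⟫ ≠ 1 := fun h => by
      have := (Real.cos_eq_one_iff_of_lt_of_lt (by linarith [hξ.1, Real.pi_pos]) hξ.2).mp h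
      exact hξ.1.ne' this
    rw [Function.mem_support]
    refine mul_ne_zero (sub_ne_zero.mpr hcos.symm) ?_
    have := norm_pos_iff.mpr hne
    unfold spectralWeight
    positivity

/-- The spectral representation of the variogram `‖s‖^{2β}`. -/
theorem exists_spectralVariogram_eq (hr : 1 ≤ r) (h0 : 0 < β) (h1 : β < 1) :
    ∃ C : ℝ, 0 < C ∧ ∀ s : E r, spectralVariogram r β s = C * ‖s‖ ^ (2 * β) := by
  set e : E r := EuclideanSpace.single ⟨0, hr⟩ 1 with he
  have hen : ‖e‖ = 1 := by simp [he]
  refine ⟨spectralVariogram r β e, spectralVariogram_pos hr h0 h1 hen, fun s => ?_⟩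
  rcases eq_or_ne s 0 with rfl | hs
  · rw [norm_zero, Real.zero_rpow (by positivity)]
    simp [spectralVariogram]
  have hpos : 0 < ‖s‖ := norm_pos_iff.mpr hs
  have hun : ‖e‖ = ‖‖s‖⁻¹ • s‖ := by
    rw [norm_smul, norm_inv, norm_norm, inv_mul_cancel₀ hpos.ne', hen]
  -- The reflection in the hyperplane orthogonal to e - s/‖s‖ carries e to s/‖s‖, which reduces
  -- every direction to e.
  have h2 := spectralVariogram_linearIsometryEquiv (β := β)
    (Submodule.reflection (ℝ ∙ (e - ‖s‖⁻¹ • s))ᗮ) e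
  rw [Submodule.reflection_sub hun] at h2
  have h3 := spectralVariogram_smul (β := β) hpos (‖s‖⁻¹ • s)
  rw [smul_inv_smul₀ hpos.ne', h2, mul_comm] at h3
  exact h3

/-! ### Increment sums and their spectral energy -/

/-- The Fourier-side increment sum `∑ c_u (e^{-i⟪u, ξ⟫} - 1)`. -/
noncomputable def increment (c : cube r →₀ ℝ) (ξ : E r) : ℂ :=
  c.sum fun u a => (a : ℂ) * (Complex.exp (-(Complex.I * ((⟪(u : E r), ξ⟫ : ℝ) : ℂ))) - 1)

theorem increment_zero (c : cube r →₀ ℝ) : increment c 0 = 0 := by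
  simp [increment, Finsupp.sum]

theorem continuous_increment (c : cube r →₀ ℝ) : Continuous (increment c) := by
  unfold increment Finsupp.sum
  fun_prop

/-- Re((e^{-ix} - 1)(e^{iy} - 1)) = cos(x - y) - cos x - cos y + 1, grouped into terms 1 - cos
because only these are integrable against the spectral density. -/
theorem normSq_increment (c : cube r →₀ ℝ) (ξ : E r) :
    ‖increment c ξ‖ ^ 2 = c.sum fun s a => c.sum fun t b => a * b *
      ((1 - Real.cos ⟪(s : E r), ξ⟫) + (1 - Real.cos ⟪(t : E r), ξ⟫)
        - (1 - Real.cos ⟪(s : E r) - t, ξ⟫)) := by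
  have hre : (increment c ξ).re = ∑ u ∈ c.support, c u * (Real.cos ⟪(u : E r), ξ⟫ - 1) := by
    simp [increment, Finsupp.sum, Complex.exp_re]
  have him : (increment c ξ).im = ∑ u ∈ c.support, c u * -Real.sin ⟪(u : E r), ξ⟫ := by
    simp [increment, Finsupp.sum, Complex.exp_im]
  rw [← Complex.normSq_eq_norm_sq, Complex.normSq_apply, hre, him, Finset.sum_mul_sum,
    Finset.sum_mul_sum, ← Finset.sum_add_distrib]
  refine Finset.sum_congr rfl fun s _ => ?_
  rw [← Finset.sum_add_distrib]
  refine Finset.sum_congr rfl fun t _ => ?_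
  simp only [inner_sub_left, Real.cos_sub]
  ring

theorem integrable_normSq_increment_mul_spectralWeight (hr : 1 ≤ r) (h0 : 0 < β) (h1 : β < 1)
    (c : cube r →₀ ℝ) :
    Integrable fun ξ : E r => ‖increment c ξ‖ ^ 2 * spectralWeight r β ξ := by
  have hI := integrable_one_sub_cos_mul_spectralWeight hr h0 h1
  simp only [normSq_increment, Finsupp.sum, Finset.sum_mul]
  refine integrable_finsetSum _ fun s _ => integrable_finsetSum _ fun t _ => ?_
  refine ((((hI s).add (hI t)).sub (hI (s - t))).const_mul (c s * c t)).congr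
    (Filter.Eventually.of_forall fun ξ => ?_)
  simp only [Pi.add_apply, Pi.sub_apply]
  ring

theorem integral_normSq_increment_mul_spectralWeight (hr : 1 ≤ r) (h0 : 0 < β) (h1 : β < 1)
    (c : cube r →₀ ℝ) :
    ∫ ξ : E r, ‖increment c ξ‖ ^ 2 * spectralWeight r β ξ =
      c.sum fun s a => c.sum fun t b => a * b * (spectralVariogram r β s
        + spectralVariogram r β t - spectralVariogram r β ((s : E r) - t)) := by
  have hI := integrable_one_sub_cos_mul_spectralWeight hr h0 h1
  have hJ : ∀ s t : cube r, Integrable fun ξ : E r => c s * c t *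
      ((1 - Real.cos ⟪(s : E r), ξ⟫) + (1 - Real.cos ⟪(t : E r), ξ⟫)
        - (1 - Real.cos ⟪(s : E r) - t, ξ⟫)) * spectralWeight r β ξ := fun s t => by
    refine ((((hI s).add (hI t)).sub (hI (s - t))).const_mul (c s * c t)).congr
      (Filter.Eventually.of_forall fun ξ => ?_)
    simp only [Pi.add_apply, Pi.sub_apply]
    ring
  simp only [normSq_increment, Finsupp.sum, Finset.sum_mul]
  rw [integral_finsetSum _ fun s _ => integrable_finsetSum _ fun t _ => hJ s t]
  refine Finset.sum_congr rfl fun s _ => ?_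
  rw [integral_finsetSum _ fun t _ => hJ s t]
  refine Finset.sum_congr rfl fun t _ => ?_
  unfold spectralVariogram
  have e := integral_sub ((hI s).add (hI t)) (hI (s - t))
  simp only [Pi.add_apply] at e
  rw [← integral_add (hI s) (hI t), ← e, ← integral_const_mul]
  refine integral_congr_ae (Filter.Eventually.of_forall fun ξ => ?_)
  ring

/-! ### Covariance of the released process -/

section Covariance

variable {Ω : Type*} [MeasurableSpace Ω] {P : Measure Ω} {X : cube r → Ω → ℝ} {Z : Ω → ℝ}

theorem IsLevyFBM.memLp (hX : IsLevyFBM β X P) (u : cube r) : MemLp (X u) 2 P :=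
  (hX.gaussian.hasGaussianLaw_eval u).memLp_two

theorem IsLevyFBM.integral_sq (hX : IsLevyFBM β X P) (u : cube r) :
    ∫ ω, X u ω ^ 2 ∂P = ‖(u : E r)‖ ^ (2 * β) := by
  have h := hX.increments u (cubeZero r)
  rw [show ((cubeZero r : cube r) : E r) = 0 from rfl, sub_zero] at h
  rw [← h]
  refine integral_congr_ae ?_
  filter_upwards [hX.zero] with ω hω
  rw [hω, sub_zero, sq_abs]

theorem IsLevyFBM.integral_mul (hX : IsLevyFBM β X P) (s t : cube r) :
    ∫ ω, X s ω * X t ω ∂P =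
      (‖(s : E r)‖ ^ (2 * β) + ‖(t : E r)‖ ^ (2 * β) - ‖(s : E r) - t‖ ^ (2 * β)) / 2 := by
  have h := hX.increments s t
  have hs := (hX.memLp s).integrable_sq
  have ht := (hX.memLp t).integrable_sq
  have hst : Integrable (fun ω => X s ω * X t ω) P := (hX.memLp s).integrable_mul (hX.memLp t)
  have hexp : ∀ ω, |X s ω - X t ω| ^ 2 = X s ω ^ 2 + X t ω ^ 2 - 2 * (X s ω * X t ω) := fun ω => by
    rw [sq_abs]; ring
  simp only [hexp] at h
  have e := integral_sub (hs.add ht) (hst.const_mul 2)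
  simp only [Pi.add_apply] at e
  rw [e, integral_const_mul, integral_add hs ht, hX.integral_sq, hX.integral_sq] at h
  linarith

/-- The cross terms vanish because Z is centered and independent of X; the summand 1 is the variance
of Z. -/
theorem integral_releasedAtZero_mul [IsProbabilityMeasure P] (hX : IsLevyFBM β X P)
    (hZ : HasLaw Z (gaussianReal 0 1) P) (hXZ : IndepFun Z (fun ω u => X u ω) P) (s t : cube r) :
    ∫ ω, releasedAtZero Z X s ω * releasedAtZero Z X t ω ∂P = 1 +
      (‖(s : E r)‖ ^ (2 * β) + ‖(t : E r)‖ ^ (2 * β) - ‖(s : E r) - t‖ ^ (2 * β)) / 2 := by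
  have hZL : MemLp Z 2 P := hZ.hasGaussianLaw.memLp_two
  have hZ0 : ∫ ω, Z ω ∂P = 0 := by
    rw [hZ.integral_eq]; simp
  have hZ2 : ∫ ω, Z ω ^ 2 ∂P = 1 := by
    have h := variance_of_integral_eq_zero hZ.aemeasurable hZ0
    rw [hZ.variance_eq] at h
    simpa using h.symm
  have hcross : ∀ u, ∫ ω, Z ω * X u ω ∂P = 0 := fun u => by
    have hi : IndepFun Z (X u) P := hXZ.comp measurable_id (measurable_pi_apply u)
    rw [hi.integral_fun_mul_eq_mul_integral hZL.aestronglyMeasurable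
      (hX.memLp u).aestronglyMeasurable, hZ0, zero_mul]
  have hst : Integrable (fun ω => X s ω * X t ω) P := (hX.memLp s).integrable_mul (hX.memLp t)
  have hzs : ∀ u, Integrable (fun ω => Z ω * X u ω) P := fun u =>
    hZL.integrable_mul (hX.memLp u)
  have hexp : ∀ ω, releasedAtZero Z X s ω * releasedAtZero Z X t ω
      = (Z ω ^ 2 + X s ω * X t ω) + (Z ω * X s ω + Z ω * X t ω) := fun ω => by
    unfold releasedAtZero; ring
  simp only [hexp]
  have e1 := integral_add (hZL.integrable_sq.add hst) ((hzs s).add (hzs t))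
  have e2 := integral_add hZL.integrable_sq hst
  have e3 := integral_add (hzs s) (hzs t)
  simp only [Pi.add_apply] at e1
  rw [e1, e2, e3, hcross, hcross, hZ2, hX.integral_mul]
  ring

/-- The quadratic form of the covariance of `Z + X` in spectral form. -/
theorem sum_covariance_eq [IsProbabilityMeasure P] (hr : 1 ≤ r) (h0 : 0 < β) (h1 : β < 1)
    (hX : IsLevyFBM β X P) (hZ : HasLaw Z (gaussianReal 0 1) P)
    (hXZ : IndepFun Z (fun ω u => X u ω) P) {C : ℝ} (hC : 0 < C)
    (hCs : ∀ s : E r, spectralVariogram r β s = C * ‖s‖ ^ (2 * β)) (c : cube r →₀ ℝ) :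
    (c.sum fun s a => c.sum fun t b => a * b * covKernel (releasedAtZero Z X) P s t 1)
      = (c.sum fun _ a => a) ^ 2
        + (2 * C)⁻¹ * ∫ ξ : E r, ‖increment c ξ‖ ^ 2 * spectralWeight r β ξ := by
  rw [integral_normSq_increment_mul_spectralWeight hr h0 h1]
  simp only [Finsupp.sum]
  rw [sq, Finset.sum_mul_sum, Finset.mul_sum, ← Finset.sum_add_distrib]
  simp only [Finset.mul_sum, ← Finset.sum_add_distrib]
  refine Finset.sum_congr rfl fun s _ => Finset.sum_congr rfl fun t _ => ?_
  simp only [covKernel, Matrix.of_apply, _root_.smul_apply,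
    ContinuousLinearMap.id_apply, smul_eq_mul, mul_one,
    integral_releasedAtZero_mul hX hZ hXZ, hCs]
  field_simp

end Covariance

/-! ### Smoothing, its approximation error, and Fourier inversion -/

open FourierTransform

variable {K σ : ℝ}

/-- `𝓕` has the phase e^{-2πi⟨v,w⟩}, so w = -ξ/(2π) produces e^{i⟨v,ξ⟩}. -/
theorem fourierHat_eq_fourier (f : E r → ℝ) (ξ : E r) :
    fourierHat f ξ = (((2 * Real.pi) ^ (-(r : ℝ) / 2) : ℝ) : ℂ) *
      𝓕 (fun v => (f v : ℂ)) ((-(2 * Real.pi)⁻¹) • ξ) := by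
  rw [fourierHat, Real.fourier_eq']
  congr 1
  refine integral_congr_ae (Filter.Eventually.of_forall fun v => ?_)
  simp only [smul_eq_mul, real_inner_smul_right]
  congr 2
  rw [mul_comm Complex.I]
  congr 2
  field_simp

theorem continuous_fourierHat {f : E r → ℝ} (hf : Integrable f) : Continuous (fourierHat f) := by
  have h : Continuous (𝓕 (fun v => (f v : ℂ))) :=
    VectorFourier.fourierIntegral_continuous Real.continuous_fourierChar
      (by exact continuous_inner) hf.ofReal
  simp only [funext (fourierHat_eq_fourier f)]
  fun_prop

theorem fourierHat_rescale (hσ : 0 < σ) (φ : E r → ℝ) (ξ : E r) :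
    fourierHat (rescale σ φ) ξ = fourierHat φ (σ • ξ) := by
  unfold fourierHat rescale
  congr 1
  have h := Measure.integral_comp_inv_smul_of_nonneg (volume : Measure (E r))
    (fun u => Complex.exp (Complex.I * ((⟪u, σ • ξ⟫ : ℝ) : ℂ)) * (φ u : ℂ)) hσ.le
  rw [finrank_euclideanSpace, Fintype.card_fin, ← inv_smul_eq_iff₀ (by positivity),
    ← integral_smul] at h
  rw [← h]
  refine integral_congr_ae (Filter.Eventually.of_forall fun u => ?_)
  simp only [real_inner_smul_left, real_inner_smul_right, mul_inv_cancel_left₀ hσ.ne',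
    Complex.real_smul]
  push_cast
  ring

theorem integrable_rescale (hσ : 0 < σ) {φ : E r → ℝ} (hφ : Integrable φ) :
    Integrable (rescale σ φ) :=
  (hφ.comp_smul (inv_ne_zero hσ.ne')).const_mul _

theorem supNorm_nonneg (x : E r) : 0 ≤ supNorm x := norm_nonneg _

theorem continuous_supNorm : Continuous (supNorm (r := r)) := by
  unfold supNorm; fun_prop

theorem supNorm_smul (a : ℝ) (x : E r) : supNorm (a • x) = |a| * supNorm x := by
  simp [supNorm, norm_smul]

theorem MemHolderBall.continuous (hβ : 0 < β) {h : E r → ℝ}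
    (hh : MemHolderBall β K h) : Continuous h := by
  refine continuous_iff_continuousAt.mpr fun x => ?_
  rw [ContinuousAt, tendsto_iff_norm_sub_tendsto_zero]
  have hcont : Continuous fun y : E r => (2 ^ β)⁻¹ * (K * supNorm (y - x) ^ β) := by
    have := continuous_supNorm (r := r)
    exact continuous_const.mul (continuous_const.mul
      ((this.comp (continuous_id.sub continuous_const)).rpow_const fun _ => Or.inr hβ.le))
  have h0 : Filter.Tendsto (fun y : E r => (2 ^ β)⁻¹ * (K * supNorm (y - x) ^ β))
      (nhds x) (nhds 0) := by
    have := hcont.tendsto x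
    simpa [supNorm, Real.zero_rpow hβ.ne'] using this
  refine squeeze_zero (fun _ => norm_nonneg _) (fun y => ?_) h0
  rw [Real.norm_eq_abs, le_inv_mul_iff₀ (by positivity)]
  exact hh.holder y x

theorem MemHolderBall.abs_le {h : E r → ℝ} (hh : MemHolderBall β K h) (x : E r) : |h x| ≤ 1 :=
  _root_.abs_le.mpr (hh.mem_Icc x)

theorem continuous_smooth {h φ : E r → ℝ} (hc : Continuous h) (hb : ∀ x, |h x| ≤ 1)
    (hφ : Integrable φ) (hσ : 0 < σ) : Continuous (smooth h φ σ) :=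
  BddAbove.continuous_convolution_left_of_integrable _
    ⟨1, by rintro _ ⟨x, rfl⟩; exact hb x⟩ hc (integrable_rescale hσ hφ)

theorem integrable_smooth {h φ : E r → ℝ} (hh : Integrable h) (hφ : Integrable φ) (hσ : 0 < σ) :
    Integrable (smooth h φ σ) :=
  hh.integrable_convolution _ (integrable_rescale hσ hφ)

theorem smooth_eq_integral {h φ : E r → ℝ} (hσ : 0 < σ) (u : E r) :
    smooth h φ σ u = ∫ v, h (u - σ • v) * φ v := by
  unfold smooth
  rw [convolution_mul_swap]
  have h1 := Measure.integral_comp_inv_smul_of_nonneg (volume : Measure (E r))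
    (fun v => h (u - σ • v) * φ v) hσ.le
  rw [finrank_euclideanSpace, Fintype.card_fin, ← inv_smul_eq_iff₀ (by positivity),
    ← integral_smul] at h1
  rw [← h1]
  refine integral_congr_ae (Filter.Eventually.of_forall fun v => ?_)
  simp only [rescale, smul_inv_smul₀ hσ.ne', smul_eq_mul]
  ring

theorem IsRegularKernel.integrable_abs_moment {φ : E r → ℝ} (hφ : IsRegularKernel β φ) :
    Integrable fun v : E r => supNorm v ^ β * |φ v| := by
  refine hφ.moment.abs.congr (Filter.Eventually.of_forall fun v => ?_)
  simp only [abs_mul, abs_of_nonneg (Real.rpow_nonneg (supNorm_nonneg v) β)]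

/-- As φ has mass one, the error is the integral of (h(u - σv) - h(u)) φ(v), and the Hölder
condition bounds the increment by 2^{-β} K σ^β |v|_∞^β. -/
theorem abs_smooth_sub_le (hβ : 0 < β) {h φ : E r → ℝ} (hh : MemHolderBall β K h)
    (hφ : IsRegularKernel β φ) (hσ : 0 < σ) (u : E r) :
    |smooth h φ σ u - h u| ≤ K * ((2 ^ β)⁻¹ * ∫ v, supNorm v ^ β * |φ v|) * σ ^ β := by
  have hc := hh.continuous hβ
  have hi : Integrable fun v => h (u - σ • v) * φ v :=
    hφ.integrable.bdd_mul (c := 1) (Continuous.aestronglyMeasurable (by fun_prop))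
      (Filter.Eventually.of_forall fun v => hh.abs_le _)
  have h1 : smooth h φ σ u - h u = ∫ v, (h (u - σ • v) - h u) * φ v := by
    have e1 : ∫ v, h u * φ v = h u := by rw [integral_const_mul, hφ.integral_eq_one, mul_one]
    simp only [sub_mul]
    rw [smooth_eq_integral hσ, integral_sub hi (hφ.integrable.const_mul _), e1]
  have h2 : K * ((2 ^ β)⁻¹ * ∫ v, supNorm v ^ β * |φ v|) * σ ^ β
      = ∫ v, (2 ^ β)⁻¹ * K * σ ^ β * (supNorm v ^ β * |φ v|) := by
    rw [integral_const_mul]; ring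
  rw [h1, h2, ← Real.norm_eq_abs]
  refine norm_integral_le_of_norm_le (hφ.integrable_abs_moment.const_mul _)
    (Filter.Eventually.of_forall fun v => ?_)
  rw [Real.norm_eq_abs, abs_mul]
  have h3 := hh.holder (u - σ • v) u
  rw [show u - σ • v - u = (-σ) • v by simp, supNorm_smul, abs_neg, abs_of_pos hσ,
    Real.mul_rpow hσ.le (supNorm_nonneg v), ← le_inv_mul_iff₀ (by positivity)] at h3
  calc |h (u - σ • v) - h u| * |φ v|
      ≤ (2 ^ β)⁻¹ * (K * (σ ^ β * supNorm v ^ β)) * |φ v| := by gcongr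
    _ = _ := by ring

/-- The convolution theorem for the unnormalized transform; each of the two factors contributes
(2π)^{r/2} when rewritten with `fourierHat`. -/
theorem fourier_smooth {h φ : E r → ℝ} (hh : Integrable h) (hφ : Integrable φ) (hσ : 0 < σ)
    (ξ : E r) :
    𝓕 (fun v => (smooth h φ σ v : ℂ)) ((-(2 * Real.pi)⁻¹) • ξ) =
      (((2 * Real.pi) ^ r : ℝ) : ℂ) * (fourierHat h ξ * fourierHat φ (σ • ξ)) := by
  have h1 : (fun v => (smooth h φ σ v : ℂ)) =
      (fun v => (h v : ℂ)) ⋆[ContinuousLinearMap.mul ℂ ℂ, volume]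
        fun v => (rescale σ φ v : ℂ) := by
    funext v
    simp only [smooth, convolution_def, ContinuousLinearMap.mul_apply']
    rw [← integral_complex_ofReal]
    simp
  rw [h1, Real.fourier_mul_convolution_eq (f₁ := fun v => (h v : ℂ))
      (f₂ := fun v => (rescale σ φ v : ℂ)) hh.ofReal (integrable_rescale hσ hφ).ofReal,
    ← fourierHat_rescale hσ, fourierHat_eq_fourier, fourierHat_eq_fourier]
  have h2 : (((2 * Real.pi) ^ r : ℝ) : ℂ) * ((((2 * Real.pi) ^ (-(r : ℝ) / 2) : ℝ) : ℂ)
      * (((2 * Real.pi) ^ (-(r : ℝ) / 2) : ℝ) : ℂ)) = 1 := by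
    rw [← Complex.ofReal_mul, ← Complex.ofReal_mul, ← Real.rpow_add (by positivity),
      ← Real.rpow_natCast, ← Real.rpow_add (by positivity)]
    rw [← Complex.ofReal_one, ← Real.rpow_zero (2 * Real.pi)]
    congr 2
    ring
  linear_combination (-(𝓕 (fun v => (h v : ℂ)) ((-(2 * Real.pi)⁻¹) • ξ) *
    𝓕 (fun v => (rescale σ φ v : ℂ)) ((-(2 * Real.pi)⁻¹) • ξ))) * h2

/-- Fourier inversion for the smoothed function. -/
theorem smooth_eq_fourier_integral {h φ : E r → ℝ} (hc : Continuous h) (hb : ∀ x, |h x| ≤ 1)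
    (hh : Integrable h) (hφ : Integrable φ) (hσ : 0 < σ)
    (hG : Integrable fun ξ : E r => fourierHat h ξ * fourierHat φ (σ • ξ)) (u : E r) :
    (smooth h φ σ u : ℂ) = ∫ ξ : E r, Complex.exp (-(Complex.I * ((⟪u, ξ⟫ : ℝ) : ℂ))) *
      (fourierHat h ξ * fourierHat φ (σ • ξ)) := by
  set g : E r → ℂ := fun v => (smooth h φ σ v : ℂ) with hg
  have hgc : Continuous g := Complex.continuous_ofReal.comp (continuous_smooth hc hb hφ hσ)
  have hgi : Integrable g := (integrable_smooth hh hφ hσ).ofReal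
  have hR : (-(2 * Real.pi)⁻¹ : ℝ) ≠ 0 := neg_ne_zero.mpr (by positivity)
  have hFi : Integrable (𝓕 g) := by
    rw [← integrable_comp_smul_iff volume _ hR]
    simp only [hg, fourier_smooth hh hφ hσ]
    exact hG.const_mul _
  have hinv := congrFun (hgc.fourierInv_fourier_eq hgi hFi) u
  rw [Real.fourierInv_eq'] at hinv
  have hsc := Measure.integral_comp_smul (volume : Measure (E r))
    (fun v => Complex.exp (((2 * Real.pi * ⟪v, u⟫ : ℝ) : ℂ) * Complex.I) • 𝓕 g v)
    (-(2 * Real.pi)⁻¹)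
  rw [hinv, finrank_euclideanSpace, Fintype.card_fin] at hsc
  -- This Jacobian cancels the factor (2π)^r of `fourier_smooth`, so the inversion formula carries
  -- no constant.
  have habs : |((-(2 * Real.pi)⁻¹) ^ r)⁻¹| = (2 * Real.pi) ^ r := by
    rw [abs_inv, abs_pow, abs_neg, abs_of_pos (by positivity), inv_pow, inv_inv]
  rw [habs, eq_comm, ← eq_inv_smul_iff₀ (by positivity), ← integral_smul] at hsc
  change g u = _
  rw [hsc]
  refine integral_congr_ae (Filter.Eventually.of_forall fun ξ => ?_)
  simp only [hg, fourier_smooth hh hφ hσ, real_inner_smul_left, smul_eq_mul, Complex.real_smul]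
  have hexp : ((2 * Real.pi * (-(2 * Real.pi)⁻¹ * ⟪u, ξ⟫) : ℝ) : ℂ) * Complex.I
      = -(Complex.I * ((⟪u, ξ⟫ : ℝ) : ℂ)) := by
    rw [show 2 * Real.pi * (-(2 * Real.pi)⁻¹ * ⟪u, ξ⟫) = -⟪u, ξ⟫ by field_simp]
    push_cast; ring
  rw [real_inner_comm u ξ, hexp]
  have hne : (((2 * Real.pi) ^ r : ℝ) : ℂ) ≠ 0 := by
    exact_mod_cast (by positivity : ((2 * Real.pi) ^ r : ℝ) ≠ 0)
  rw [Complex.ofReal_inv]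
  field_simp

end LevyFBM

/-! ### Cauchy–Schwarz and Sobolev estimates on the Fourier side -/

theorem MeasureTheory.sq_integral_mul_le {α : Type*} [MeasurableSpace α] {μ : Measure α}
    {f g : α → ℝ} (hf0 : ∀ x, 0 ≤ f x) (hg0 : ∀ x, 0 ≤ g x) (hf : MemLp f 2 μ)
    (hg : MemLp g 2 μ) :
    (∫ x, f x * g x ∂μ) ^ 2 ≤ (∫ x, f x ^ 2 ∂μ) * ∫ x, g x ^ 2 ∂μ := by
  have h := integral_mul_le_Lp_mul_Lq_of_nonneg (μ := μ) (p := 2) (q := 2)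
    Real.HolderConjugate.two_two (Filter.Eventually.of_forall hf0)
    (Filter.Eventually.of_forall hg0) (by simpa using hf) (by simpa using hg)
  have h0 : 0 ≤ ∫ x, f x * g x ∂μ := integral_nonneg fun x => mul_nonneg (hf0 x) (hg0 x)
  have h1 : 0 ≤ ∫ x, f x ^ 2 ∂μ := integral_nonneg fun x => sq_nonneg _
  have h2 : 0 ≤ ∫ x, g x ^ 2 ∂μ := integral_nonneg fun x => sq_nonneg _
  simp only [Real.rpow_two, ← Real.sqrt_eq_rpow] at h
  calc (∫ x, f x * g x ∂μ) ^ 2 ≤ (√(∫ x, f x ^ 2 ∂μ) * √(∫ x, g x ^ 2 ∂μ)) ^ 2 := by gcongr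
    _ = _ := by rw [mul_pow, Real.sq_sqrt h1, Real.sq_sqrt h2]

namespace LevyFBM

variable {r : ℕ} {β K σ : ℝ}

theorem MemSobolevBall.integral_weighted_le {h : E r → ℝ} (hh : MemSobolevBall β K h) :
    ∫ ξ : E r, ‖fourierHat h ξ‖ ^ 2 * (1 + ‖ξ‖) ^ (2 * β) ≤
      (2 * Real.pi) ^ ((r : ℝ) / 2) * K ^ 2 := by
  have h1 := hh.integral_le
  rw [neg_div, Real.rpow_neg (by positivity), inv_mul_le_iff₀ (by positivity)] at h1
  exact h1

theorem le_sobolevWeight (hβ : 0 < β) (h : E r → ℝ) (ξ : E r) :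
    ‖fourierHat h ξ‖ ^ 2 ≤ ‖fourierHat h ξ‖ ^ 2 * (1 + ‖ξ‖) ^ (2 * β) :=
  le_mul_of_one_le_right (sq_nonneg _)
    (Real.one_le_rpow (by linarith [norm_nonneg ξ]) (by positivity))

theorem MemSobolevBall.integrable_normSq (hβ : 0 < β) {h : E r → ℝ}
    (hh : MemSobolevBall β K h) : Integrable fun ξ : E r => ‖fourierHat h ξ‖ ^ 2 := by
  have hc := continuous_fourierHat hh.integrable
  refine hh.integrable_sq.mono' (Continuous.aestronglyMeasurable (by fun_prop))
    (Filter.Eventually.of_forall fun ξ => ?_)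
  rw [Real.norm_of_nonneg (sq_nonneg _)]
  exact le_sobolevWeight hβ h ξ

theorem MemSobolevBall.integral_normSq_le (hβ : 0 < β) {h : E r → ℝ}
    (hh : MemSobolevBall β K h) :
    ∫ ξ : E r, ‖fourierHat h ξ‖ ^ 2 ≤ (2 * Real.pi) ^ ((r : ℝ) / 2) * K ^ 2 :=
  (integral_mono (hh.integrable_normSq hβ) hh.integrable_sq (le_sobolevWeight hβ h)).trans
    hh.integral_weighted_le

theorem memLp_norm_of_integrable_normSq {f : E r → ℂ} (hc : Continuous f)
    (hf : Integrable fun ξ => ‖f ξ‖ ^ 2) : MemLp (fun ξ => ‖f ξ‖) 2 :=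
  (memLp_two_iff_integrable_sq hc.norm.aestronglyMeasurable).mpr hf

section Estimates

variable {h φ : E r → ℝ}

theorem memLp_norm_fourierHat_smul (hφ : IsRegularKernel β φ) (hσ : 0 < σ) :
    MemLp (fun ξ : E r => ‖fourierHat φ (σ • ξ)‖) 2 := by
  have hc := continuous_fourierHat hφ.integrable
  exact memLp_norm_of_integrable_normSq (f := fun ξ => fourierHat φ (σ • ξ)) (by fun_prop)
    (hφ.fourier_sq.comp_smul hσ.ne')

/-- A product of two square-integrable functions; this is what makes Fourier inversion available for
the smoothed function. -/
theorem integrable_fourierHat_mul (hβ : 0 < β) (hh : MemSobolevBall β K h)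
    (hφ : IsRegularKernel β φ) (hσ : 0 < σ) :
    Integrable fun ξ : E r => fourierHat h ξ * fourierHat φ (σ • ξ) := by
  have hc1 := continuous_fourierHat hh.integrable
  have hc2 := continuous_fourierHat hφ.integrable
  have h1 := (memLp_norm_of_integrable_normSq hc1 (hh.integrable_normSq hβ)).integrable_mul
    (memLp_norm_fourierHat_smul hφ hσ)
  refine h1.mono' (Continuous.aestronglyMeasurable (by fun_prop))
    (Filter.Eventually.of_forall fun ξ => ?_)
  rw [norm_mul]
  rfl

/-- Controls the smoothed function at the origin. Cauchy–Schwarz splits the factors; the dilation of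
φ̂ gives σ^{-r}, and the Sobolev weight is at least 1. -/
theorem sq_integral_norm_fourierHat_mul_le (hβ : 0 < β) (hh : MemSobolevBall β K h)
    (hφ : IsRegularKernel β φ) (hσ : 0 < σ) :
    (∫ ξ : E r, ‖fourierHat h ξ * fourierHat φ (σ • ξ)‖) ^ 2 ≤
      (2 * Real.pi) ^ ((r : ℝ) / 2) * K ^ 2 *
        ((σ ^ r)⁻¹ * ∫ ξ : E r, ‖fourierHat φ ξ‖ ^ 2) := by
  have hc1 := continuous_fourierHat hh.integrable
  have h1 := sq_integral_mul_le (fun _ => norm_nonneg _) (fun _ => norm_nonneg _)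
    (memLp_norm_of_integrable_normSq hc1 (hh.integrable_normSq hβ))
    (memLp_norm_fourierHat_smul hφ hσ)
  have h2 := Measure.integral_comp_smul_of_nonneg (volume : Measure (E r))
    (fun ξ => ‖fourierHat φ ξ‖ ^ 2) σ (hR := hσ.le)
  rw [finrank_euclideanSpace, Fintype.card_fin, smul_eq_mul] at h2
  rw [h2] at h1
  simp only [norm_mul]
  refine h1.trans ?_
  have : 0 ≤ ∫ ξ : E r, ‖fourierHat φ ξ‖ ^ 2 := integral_nonneg fun _ => sq_nonneg _
  gcongr
  exact hh.integral_normSq_le hβ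

/-- The decay of φ̂, applied at σξ, absorbs ‖ξ‖^r at the cost of σ^{-r}; the remaining ‖ξ‖^{2β} is
below the Sobolev weight. -/
theorem normSq_fourierHat_mul_le (hβ : 0 < β) (hσ : 0 < σ) {B : ℝ}
    (hB : ∀ ξ, ‖fourierHat φ ξ‖ ^ 2 * ‖ξ‖ ^ r ≤ B) (ξ : E r) :
    ‖fourierHat h ξ * fourierHat φ (σ • ξ)‖ ^ 2 * ‖ξ‖ ^ (2 * β + r) ≤
      (σ ^ r)⁻¹ * B * (‖fourierHat h ξ‖ ^ 2 * (1 + ‖ξ‖) ^ (2 * β)) := by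
  have h1 := hB (σ • ξ)
  rw [norm_smul, Real.norm_of_nonneg hσ.le, mul_pow] at h1
  have h2 : ‖fourierHat φ (σ • ξ)‖ ^ 2 * ‖ξ‖ ^ r ≤ (σ ^ r)⁻¹ * B := by
    rw [le_inv_mul_iff₀ (by positivity)]
    linarith
  have h3 : ‖ξ‖ ^ (2 * β) ≤ (1 + ‖ξ‖) ^ (2 * β) := by gcongr; linarith
  rw [Real.rpow_add_of_nonneg (norm_nonneg ξ) (by positivity) (by positivity),
    Real.rpow_natCast, norm_mul, mul_pow]
  calc ‖fourierHat h ξ‖ ^ 2 * ‖fourierHat φ (σ • ξ)‖ ^ 2 * (‖ξ‖ ^ (2 * β) * ‖ξ‖ ^ r)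
      = (‖fourierHat φ (σ • ξ)‖ ^ 2 * ‖ξ‖ ^ r) * (‖fourierHat h ξ‖ ^ 2 * ‖ξ‖ ^ (2 * β)) := by ring
    _ ≤ _ := by
      refine mul_le_mul h2 (by gcongr) (by positivity) ((by positivity : (0 : ℝ) ≤ _).trans h2)

theorem integrable_normSq_fourierHat_mul (hβ : 0 < β) (hh : MemSobolevBall β K h)
    (hφ : IsRegularKernel β φ) (hσ : 0 < σ) {B : ℝ}
    (hB : ∀ ξ, ‖fourierHat φ ξ‖ ^ 2 * ‖ξ‖ ^ r ≤ B) :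
    Integrable fun ξ : E r =>
      ‖fourierHat h ξ * fourierHat φ (σ • ξ)‖ ^ 2 * ‖ξ‖ ^ (2 * β + r) := by
  have hc1 := continuous_fourierHat hh.integrable
  have hc2 := continuous_fourierHat hφ.integrable
  refine (hh.integrable_sq.const_mul ((σ ^ r)⁻¹ * B)).mono'
    (Measurable.aestronglyMeasurable ?_) (Filter.Eventually.of_forall fun ξ => ?_)
  · have : Measurable fun ξ : E r => fourierHat h ξ * fourierHat φ (σ • ξ) :=
      Continuous.measurable (by fun_prop)
    fun_prop
  · rw [Real.norm_of_nonneg (by positivity)]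
    exact normSq_fourierHat_mul_le hβ hσ hB ξ

theorem integral_normSq_fourierHat_mul_le (hβ : 0 < β) (hh : MemSobolevBall β K h)
    (hφ : IsRegularKernel β φ) (hσ : 0 < σ) {B : ℝ} (hB0 : 0 ≤ B)
    (hB : ∀ ξ, ‖fourierHat φ ξ‖ ^ 2 * ‖ξ‖ ^ r ≤ B) :
    ∫ ξ : E r, ‖fourierHat h ξ * fourierHat φ (σ • ξ)‖ ^ 2 * ‖ξ‖ ^ (2 * β + r) ≤
      (σ ^ r)⁻¹ * B * ((2 * Real.pi) ^ ((r : ℝ) / 2) * K ^ 2) := by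
  refine (integral_mono (integrable_normSq_fourierHat_mul hβ hh hφ hσ hB)
    (hh.integrable_sq.const_mul ((σ ^ r)⁻¹ * B)) (normSq_fourierHat_mul_le hβ hσ hB)).trans ?_
  rw [integral_const_mul]
  gcongr
  exact hh.integral_weighted_le

/-- Split e^{-i⟨u,ξ⟩} = 1 + (e^{-i⟨u,ξ⟩} - 1) in the inversion formula: the 1 reproduces the value
at the origin, matching the part of the covariance due to Z. -/
theorem sum_smooth_eq (hβ : 0 < β) (hH : MemHolderBall β K h) (hh : MemSobolevBall β K h)
    (hφ : IsRegularKernel β φ) (hσ : 0 < σ) (c : cube r →₀ ℝ) :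
    (((c.sum fun u a => a * smooth h φ σ u) : ℝ) : ℂ) =
      (((c.sum fun _ a => a) * smooth h φ σ 0 : ℝ) : ℂ) +
        ∫ ξ : E r, increment c ξ * (fourierHat h ξ * fourierHat φ (σ • ξ)) := by
  have hG := integrable_fourierHat_mul hβ hh hφ hσ
  have hinv := smooth_eq_fourier_integral (hH.continuous hβ) hH.abs_le hh.integrable
    hφ.integrable hσ hG
  have hexp : ∀ u : E r, Integrable fun ξ : E r =>
      Complex.exp (-(Complex.I * ((⟪u, ξ⟫ : ℝ) : ℂ))) *
        (fourierHat h ξ * fourierHat φ (σ • ξ)) := fun u => by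
    refine hG.bdd_mul (c := 1) (Continuous.aestronglyMeasurable (by fun_prop))
      (Filter.Eventually.of_forall fun ξ => ?_)
    rw [Complex.norm_exp]
    simp
  have hsum : ∀ ξ : E r, increment c ξ * (fourierHat h ξ * fourierHat φ (σ • ξ)) =
      ∑ u ∈ c.support, (c u : ℂ) *
        (Complex.exp (-(Complex.I * ((⟪(u : E r), ξ⟫ : ℝ) : ℂ))) *
          (fourierHat h ξ * fourierHat φ (σ • ξ)) - fourierHat h ξ * fourierHat φ (σ • ξ)) := by
    intro ξ
    simp only [increment, Finsupp.sum, Finset.sum_mul]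
    exact Finset.sum_congr rfl fun u _ => by ring
  have h0 : (smooth h φ σ 0 : ℂ) = ∫ ξ : E r, fourierHat h ξ * fourierHat φ (σ • ξ) := by
    simpa using hinv 0
  simp only [hsum]
  rw [integral_finsetSum _ fun u _ => by exact ((hexp u).sub hG).const_mul _]
  simp only [integral_const_mul]
  rw [Complex.ofReal_mul, Finsupp.sum, Finsupp.sum, Complex.ofReal_sum, Complex.ofReal_sum,
    Finset.sum_mul, ← Finset.sum_add_distrib]
  refine Finset.sum_congr rfl fun u _ => ?_
  rw [integral_sub (hexp u) hG, ← hinv, ← h0]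
  push_cast
  ring

/-- Cauchy–Schwarz after distributing ‖ξ‖^{-(β+r/2)} and ‖ξ‖^{β+r/2} over the two factors. -/
theorem sq_norm_integral_increment_mul_le (hr : 1 ≤ r) (h0 : 0 < β) (h1 : β < 1)
    (hh : MemSobolevBall β K h) (hφ : IsRegularKernel β φ) (hσ : 0 < σ) {B : ℝ}
    (hB : ∀ ξ, ‖fourierHat φ ξ‖ ^ 2 * ‖ξ‖ ^ r ≤ B) (c : cube r →₀ ℝ) :
    ‖∫ ξ : E r, increment c ξ * (fourierHat h ξ * fourierHat φ (σ • ξ))‖ ^ 2 ≤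
      (∫ ξ : E r, ‖increment c ξ‖ ^ 2 * spectralWeight r β ξ) *
        ∫ ξ : E r, ‖fourierHat h ξ * fourierHat φ (σ • ξ)‖ ^ 2 * ‖ξ‖ ^ (2 * β + r) := by
  have hc1 := continuous_fourierHat hh.integrable
  have hc2 := continuous_fourierHat hφ.integrable
  have hm : Measurable fun ξ : E r => fourierHat h ξ * fourierHat φ (σ • ξ) :=
    Continuous.measurable (by fun_prop)
  have hmi := (continuous_increment c).measurable
  set f : E r → ℝ := fun ξ => ‖increment c ξ‖ * ‖ξ‖ ^ (-(β + r / 2)) with hf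
  set g : E r → ℝ := fun ξ =>
    ‖fourierHat h ξ * fourierHat φ (σ • ξ)‖ * ‖ξ‖ ^ (β + r / 2) with hg
  have hf2 : ∀ ξ, f ξ ^ 2 = ‖increment c ξ‖ ^ 2 * spectralWeight r β ξ := fun ξ => by
    simp only [hf, mul_pow, spectralWeight]
    rw [← Real.rpow_mul_natCast (norm_nonneg ξ)]
    congr 2; push_cast; ring
  have hg2 : ∀ ξ, g ξ ^ 2 =
      ‖fourierHat h ξ * fourierHat φ (σ • ξ)‖ ^ 2 * ‖ξ‖ ^ (2 * β + r) := fun ξ => by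
    simp only [hg, mul_pow]
    rw [← Real.rpow_mul_natCast (norm_nonneg ξ)]
    congr 2; push_cast; ring
  have hfL : MemLp f 2 := by
    refine (memLp_two_iff_integrable_sq (Measurable.aestronglyMeasurable (by fun_prop))).mpr ?_
    simp only [hf2]
    exact integrable_normSq_increment_mul_spectralWeight hr h0 h1 c
  have hgL : MemLp g 2 := by
    refine (memLp_two_iff_integrable_sq (Measurable.aestronglyMeasurable (by fun_prop))).mpr ?_
    simp only [hg2]
    exact integrable_normSq_fourierHat_mul h0 hh hφ hσ hB
  have hfg : ∀ ξ, ‖increment c ξ * (fourierHat h ξ * fourierHat φ (σ • ξ))‖ = f ξ * g ξ := by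
    intro ξ
    -- At the origin the two powers do not cancel, but the increment sum vanishes there.
    rcases eq_or_ne ξ 0 with rfl | hξ
    · simp [hf, increment_zero]
    · have hpos : 0 < ‖ξ‖ := norm_pos_iff.mpr hξ
      have : ‖ξ‖ ^ (-(β + r / 2)) * ‖ξ‖ ^ (β + r / 2) = 1 := by
        rw [← Real.rpow_add hpos, neg_add_cancel, Real.rpow_zero]
      rw [norm_mul]
      linear_combination (-(‖increment c ξ‖ * ‖fourierHat h ξ * fourierHat φ (σ • ξ)‖)) * this
  have hCS := sq_integral_mul_le (fun ξ => by positivity) (fun ξ => by positivity) hfL hgL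
  simp only [hf2, hg2, ← hfg] at hCS
  refine le_trans ?_ hCS
  gcongr
  exact norm_integral_le_integral_norm _

end Estimates

/-! ### The bound on linear combinations of values -/

/-- The squared norm bound for the smoothed function, per unit of `K²`. -/
noncomputable def normConstant (r : ℕ) (φ : E r → ℝ) (C B : ℝ) : ℝ :=
  (2 * Real.pi) ^ ((r : ℝ) / 2) * ((∫ ξ : E r, ‖fourierHat φ ξ‖ ^ 2) + 2 * C * B)

/-- A two-term Cauchy–Schwarz inequality: the sum is a·b + x, with a = ∑ c_u, b the value at the
origin and x² ≤ Q·D. The weights 2C and (2C)⁻¹ fit D and Q to the covariance form. -/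
theorem sq_sum_smooth_le {h φ : E r → ℝ} (hr : 1 ≤ r) (h0 : 0 < β) (h1 : β < 1)
    (hH : MemHolderBall β K h) (hh : MemSobolevBall β K h) (hφ : IsRegularKernel β φ)
    (hσ : 0 < σ) {B C : ℝ} (hB0 : 0 ≤ B) (hB : ∀ ξ, ‖fourierHat φ ξ‖ ^ 2 * ‖ξ‖ ^ r ≤ B)
    (hC : 0 < C) (c : cube r →₀ ℝ) :
    (c.sum fun u a => a * smooth h φ σ u) ^ 2 ≤ K ^ 2 * normConstant r φ C B * (σ ^ r)⁻¹ *
      ((c.sum fun _ a => a) ^ 2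
        + (2 * C)⁻¹ * ∫ ξ : E r, ‖increment c ξ‖ ^ 2 * spectralWeight r β ξ) := by
  have hG := integrable_fourierHat_mul h0 hh hφ hσ
  have hinv := smooth_eq_fourier_integral (hH.continuous h0) hH.abs_le hh.integrable
    hφ.integrable hσ hG 0
  have hrepr := sum_smooth_eq h0 hH hh hφ hσ c
  have hx := sq_norm_integral_increment_mul_le hr h0 h1 hh hφ hσ hB c
  have hD := integral_normSq_fourierHat_mul_le h0 hh hφ hσ hB0 hB
  have hA := sq_integral_norm_fourierHat_mul_le h0 hh hφ hσ
  have hQ : 0 ≤ ∫ ξ : E r, ‖increment c ξ‖ ^ 2 * spectralWeight r β ξ :=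
    integral_nonneg fun ξ => mul_nonneg (sq_nonneg _) (spectralWeight_nonneg r β ξ)
  have hD0 : 0 ≤ ∫ ξ : E r,
      ‖fourierHat h ξ * fourierHat φ (σ • ξ)‖ ^ 2 * ‖ξ‖ ^ (2 * β + r) :=
    integral_nonneg fun ξ => by positivity
  have hs0 : |smooth h φ σ 0| ≤ ∫ ξ : E r, ‖fourierHat h ξ * fourierHat φ (σ • ξ)‖ := by
    rw [← Real.norm_eq_abs, ← Complex.norm_real, hinv]
    simpa using norm_integral_le_integral_norm
      (fun ξ : E r => fourierHat h ξ * fourierHat φ (σ • ξ))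
  have hs : smooth h φ σ 0 ^ 2 ≤
      (∫ ξ : E r, ‖fourierHat h ξ * fourierHat φ (σ • ξ)‖) ^ 2 := by
    rw [← sq_abs]; gcongr
  set S := c.sum fun u a => a * smooth h φ σ u
  set a := c.sum fun _ a => a
  set b := smooth h φ σ 0
  set I := ∫ ξ : E r, increment c ξ * (fourierHat h ξ * fourierHat φ (σ • ξ))
  set Q := ∫ ξ : E r, ‖increment c ξ‖ ^ 2 * spectralWeight r β ξ
  set D := ∫ ξ : E r, ‖fourierHat h ξ * fourierHat φ (σ • ξ)‖ ^ 2 * ‖ξ‖ ^ (2 * β + r)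
  have hx' : (S - a * b) ^ 2 ≤ Q * D := by
    refine le_trans (le_of_eq ?_) hx
    rw [← sq_abs, ← Real.norm_eq_abs, ← Complex.norm_real, Complex.ofReal_sub, hrepr]
    simp
  have hbD : b ^ 2 + 2 * C * D ≤ K ^ 2 * normConstant r φ C B * (σ ^ r)⁻¹ := by
    calc b ^ 2 + 2 * C * D ≤ (2 * Real.pi) ^ ((r : ℝ) / 2) * K ^ 2 *
          ((σ ^ r)⁻¹ * ∫ ξ : E r, ‖fourierHat φ ξ‖ ^ 2) +
          2 * C * ((σ ^ r)⁻¹ * B * ((2 * Real.pi) ^ ((r : ℝ) / 2) * K ^ 2)) := by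
          gcongr
          exact hs.trans hA
      _ = _ := by unfold normConstant; ring
  have hQC : 0 ≤ (2 * C)⁻¹ * Q := by positivity
  have key : S ^ 2 ≤ (b ^ 2 + 2 * C * D) * (a ^ 2 + (2 * C)⁻¹ * Q) := by
    set x := S - a * b
    have hS : S = a * b + x := by simp [x]
    set q := (2 * C)⁻¹ * Q with hq
    set d := 2 * C * D
    have hd : 0 ≤ d := by positivity
    have hqd : x ^ 2 ≤ q * d := by
      refine hx'.trans (le_of_eq ?_)
      simp only [hq, d]; field_simp
    -- Arithmetic–geometric mean inequality for b²q and da², whose product dominates (abx)².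
    have hcross : 2 * (a * b * x) ≤ b ^ 2 * q + d * a ^ 2 := by
      have h5 : (a * b * x) ^ 2 ≤ (b ^ 2 * q) * (d * a ^ 2) := by
        calc (a * b * x) ^ 2 = (a * b) ^ 2 * x ^ 2 := by ring
          _ ≤ (a * b) ^ 2 * (q * d) := by gcongr
          _ = _ := by ring
      have h6 : 0 ≤ b ^ 2 * q := by positivity
      have h7 : 0 ≤ d * a ^ 2 := by positivity
      refine le_of_sq_le_sq ?_ (add_nonneg h6 h7)
      nlinarith [sq_nonneg (b ^ 2 * q - d * a ^ 2)]
    rw [hS]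
    linarith [show (a * b + x) ^ 2 = a ^ 2 * b ^ 2 + 2 * (a * b * x) + x ^ 2 by ring,
      show (b ^ 2 + d) * (a ^ 2 + q) = a ^ 2 * b ^ 2 + (b ^ 2 * q + d * a ^ 2) + q * d by ring]
  exact key.trans (mul_le_mul_of_nonneg_right hbD (by positivity))

/-! ### The Gaussian density as a regular kernel -/

theorem integrable_norm_rpow_mul_exp_neg_mul_sq (hr : 1 ≤ r) {a b : ℝ} (ha : 0 ≤ a) (hb : 0 < b) :
    Integrable fun v : E r => ‖v‖ ^ a * Real.exp (-b * ‖v‖ ^ 2) := by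
  have : Nonempty (Fin r) := ⟨⟨0, hr⟩⟩
  refine (integrable_fun_norm_addHaar (volume : Measure (E r))
    (f := fun y : ℝ => y ^ a * Real.exp (-b * y ^ 2))).mpr ?_
  have h := (integrable_rpow_mul_exp_neg_mul_sq hb
    (s := ((r - 1 : ℕ) : ℝ) + a) (by linarith [Nat.cast_nonneg (α := ℝ) (r - 1)])).integrableOn
    (s := Set.Ioi 0)
  refine h.congr_fun (fun y hy => ?_) measurableSet_Ioi
  have hy0 : (0 : ℝ) < y := hy
  simp only [finrank_euclideanSpace, Fintype.card_fin, smul_eq_mul]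
  rw [Real.rpow_add hy0, Real.rpow_natCast, mul_assoc]

theorem integrable_exp_neg_mul_sq_norm (hr : 1 ≤ r) {b : ℝ} (hb : 0 < b) :
    Integrable fun v : E r => Real.exp (-b * ‖v‖ ^ 2) := by
  simpa using integrable_norm_rpow_mul_exp_neg_mul_sq hr le_rfl hb

theorem supNorm_le_norm (v : E r) : supNorm v ≤ ‖v‖ :=
  (pi_norm_le_iff_of_nonneg (norm_nonneg v)).mpr fun i => PiLp.norm_apply_le v i

/-- The standard Gaussian density on `ℝ^r`. -/
noncomputable def gaussianKernel (r : ℕ) (v : E r) : ℝ :=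
  ((Real.pi / (1 / 2)) ^ ((r : ℝ) / 2))⁻¹ * Real.exp (-(1 / 2) * ‖v‖ ^ 2)

theorem gaussianKernel_nonneg (v : E r) : 0 ≤ gaussianKernel r v := by
  unfold gaussianKernel; positivity

/-- The transform of a Gaussian is a multiple of the same Gaussian, and squaring doubles the
exponent 1/2. The kernel conditions need no value of D. -/
theorem exists_normSq_fourierHat_gaussianKernel (r : ℕ) : ∃ D : ℝ, 0 ≤ D ∧ ∀ ξ : E r,
    ‖fourierHat (gaussianKernel r) ξ‖ ^ 2 = D * Real.exp (-1 * ‖ξ‖ ^ 2) := by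
  set A : ℂ := (((2 * Real.pi) ^ (-(r : ℝ) / 2) : ℝ) : ℂ)
  set B : ℂ := ((((Real.pi / (1 / 2)) ^ ((r : ℝ) / 2))⁻¹ : ℝ) : ℂ)
  set C : ℂ := ((Real.pi : ℂ) / (1 / 2)) ^ ((Module.finrank ℝ (E r) : ℂ) / 2)
  refine ⟨‖A * B * C‖ ^ 2, by positivity, fun ξ => ?_⟩
  have h := GaussianFourier.integral_cexp_neg_mul_sq_norm_add (V := E r) (b := 1 / 2)
    (by norm_num) Complex.I ξ
  have h1 : fourierHat (gaussianKernel r) ξ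
      = A * B * C * ((Real.exp (-(1 / 2) * ‖ξ‖ ^ 2) : ℝ) : ℂ) := by
    have h2 : ∀ u : E r, Complex.exp (Complex.I * ((⟪u, ξ⟫ : ℝ) : ℂ)) * (gaussianKernel r u : ℂ)
        = B * Complex.exp (-(1 / 2) * (‖u‖ : ℂ) ^ 2 + Complex.I * ((⟪ξ, u⟫ : ℝ) : ℂ)) := fun u => by
      rw [Complex.exp_add, real_inner_comm]
      simp only [gaussianKernel, B]
      push_cast
      ring
    unfold fourierHat
    simp only [h2]
    rw [integral_const_mul, h, Complex.I_sq]
    have h3 : (-1 * (‖ξ‖ : ℂ) ^ 2 / (4 * (1 / 2))) = ((-(1 / 2) * ‖ξ‖ ^ 2 : ℝ) : ℂ) := by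
      push_cast; ring
    rw [h3, Complex.ofReal_exp]
    ring
  rw [h1, norm_mul, mul_pow, Complex.norm_real, Real.norm_of_nonneg (Real.exp_pos _).le,
    ← Real.exp_nat_mul]
  congr 2
  push_cast; ring

/-- Combine x^r ≤ r! e^x with x - x² ≤ 1. -/
theorem exp_neg_sq_mul_pow_le (r : ℕ) {x : ℝ} (hx : 0 ≤ x) :
    Real.exp (-1 * x ^ 2) * x ^ r ≤ r.factorial * Real.exp 1 := by
  have h1 := Real.pow_div_factorial_le_exp x hx r
  rw [div_le_iff₀ (by positivity)] at h1
  calc Real.exp (-1 * x ^ 2) * x ^ r ≤ Real.exp (-1 * x ^ 2) * (Real.exp x * r.factorial) := by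
        gcongr
    _ = r.factorial * Real.exp (-1 * x ^ 2 + x) := by rw [Real.exp_add]; ring
    _ ≤ _ := by
        gcongr
        nlinarith [sq_nonneg (x - 1)]

theorem isRegularKernel_gaussianKernel (hr : 1 ≤ r) {β : ℝ} (hβ : 0 < β) :
    IsRegularKernel β (gaussianKernel r) := by
  obtain ⟨D, hD0, hD⟩ := exists_normSq_fourierHat_gaussianKernel r
  have hint : Integrable (gaussianKernel r) :=
    (integrable_exp_neg_mul_sq_norm hr (by norm_num : (0 : ℝ) < 1 / 2)).const_mul _
  refine ⟨hint, ?_, ?_, ?_, ?_⟩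
  · unfold gaussianKernel
    rw [integral_const_mul, GaussianFourier.integral_rexp_neg_mul_sq_norm (by norm_num),
      finrank_euclideanSpace, Fintype.card_fin]
    exact inv_mul_cancel₀ (by positivity)
  · refine ((integrable_norm_rpow_mul_exp_neg_mul_sq hr hβ.le
      (by norm_num : (0 : ℝ) < 1 / 2)).const_mul
      ((Real.pi / (1 / 2)) ^ ((r : ℝ) / 2))⁻¹).mono'
      ((continuous_supNorm.measurable.pow_const β).aestronglyMeasurable.mul
        hint.aestronglyMeasurable) (Filter.Eventually.of_forall fun v => ?_)
    have h1 : supNorm v ^ β ≤ ‖v‖ ^ β :=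
      Real.rpow_le_rpow (supNorm_nonneg v) (supNorm_le_norm v) hβ.le
    rw [Real.norm_of_nonneg (mul_nonneg (Real.rpow_nonneg (supNorm_nonneg v) β)
      (gaussianKernel_nonneg v))]
    calc supNorm v ^ β * gaussianKernel r v ≤ ‖v‖ ^ β * gaussianKernel r v :=
          mul_le_mul_of_nonneg_right h1 (gaussianKernel_nonneg v)
      _ = _ := by unfold gaussianKernel; ring
  · simp only [hD]
    exact (integrable_exp_neg_mul_sq_norm hr one_pos).const_mul D
  · refine ⟨D * (r.factorial * Real.exp 1), ?_⟩
    rintro _ ⟨ξ, rfl⟩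
    simp only [hD, mul_assoc]
    exact mul_le_mul_of_nonneg_left (exp_neg_sq_mul_pow_le r (norm_nonneg ξ)) hD0

end LevyFBM

/-! ### Choice of constants and conclusion -/

open LevyFBM in
theorem mainTheorem9 (r : ℕ) (hr : 1 ≤ r) :
    -- regular kernels exist, even one that serves all smoothness indices
    (∃ φ : E r → ℝ, ∀ β : ℝ, 0 < β → β < 1 → IsRegularKernel β φ) ∧
    ∀ β : ℝ, 0 < β → β < 1 → ∀ φ : E r → ℝ, IsRegularKernel β φ →
      ∃ R L : ℝ, 0 < R ∧ 0 < L ∧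
        ∀ K : ℝ, 0 < K → ∀ h : E r → ℝ, MemHolderBall β K h → MemSobolevBall β K h →
        ∀ σ : ℝ, 0 < σ → σ < 1 →
          (∀ u : E r, |smooth h φ σ u - h u| ≤ K * R * σ ^ β) ∧
          ∀ {Ω : Type*} [MeasurableSpace Ω] (P : Measure Ω) [IsProbabilityMeasure P]
            (X : cube r → Ω → ℝ) (hX : IsLevyFBM β X P)
            (Z : Ω → ℝ) (hZ : HasLaw Z (gaussianReal 0 1) P)
            (_hXZ : IndepFun Z (fun ω u => X u ω) P),
            haveI := fact_posSemidef hX hZ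
            ∃ f : RKHS.OfKernel (covKernel (releasedAtZero Z X) P),
              (∀ u : cube r, f u = smooth h φ σ u) ∧
              ‖f‖ ^ 2 ≤ K ^ 2 * L ^ 2 * σ ^ (-(r : ℝ)) := by
  refine ⟨⟨gaussianKernel r, fun β h0 _ => isRegularKernel_gaussianKernel hr h0⟩, ?_⟩
  intro β h0 h1 φ hφ
  obtain ⟨C, hC, hCs⟩ := exists_spectralVariogram_eq hr h0 h1
  obtain ⟨B, hB'⟩ := hφ.fourier_decay
  have hB : ∀ ξ, ‖fourierHat φ ξ‖ ^ 2 * ‖ξ‖ ^ r ≤ B := fun ξ => hB' ⟨ξ, rfl⟩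
  have hB0 : 0 ≤ B := (by positivity : (0 : ℝ) ≤ _).trans (hB 0)
  have hM0 : 0 ≤ ∫ v : E r, supNorm v ^ β * |φ v| := integral_nonneg fun v =>
    mul_nonneg (Real.rpow_nonneg (supNorm_nonneg v) β) (abs_nonneg _)
  have hN0 : 0 ≤ normConstant r φ C B := by
    have : 0 ≤ ∫ ξ : E r, ‖fourierHat φ ξ‖ ^ 2 := integral_nonneg fun _ => sq_nonneg _
    unfold normConstant
    positivity
  -- The estimates hold without the summands 1; these only make R and L visibly positive.
  refine ⟨(2 ^ β)⁻¹ * (∫ v, supNorm v ^ β * |φ v|) + 1, √(normConstant r φ C B + 1),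
    by positivity, by positivity, ?_⟩
  intro K hK h hH hh σ hσ hσ1
  refine ⟨fun u => (abs_smooth_sub_le h0 hH hφ hσ u).trans ?_, ?_⟩
  · gcongr
    linarith
  intro Ω _ P _ X hX Z hZ hXZ
  have := fact_posSemidef hX hZ
  have hnn : 0 ≤ K ^ 2 * √(normConstant r φ C B + 1) ^ 2 * σ ^ (-(r : ℝ)) := by positivity
  obtain ⟨f, hf, hfn⟩ := RKHS.exists_eq_of_sq_sum_le
    (H := RKHS.OfKernel (covKernel (releasedAtZero Z X) P))
    (fun u : cube r => smooth h φ σ u) (Real.sqrt_nonneg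
      (K ^ 2 * √(normConstant r φ C B + 1) ^ 2 * σ ^ (-(r : ℝ)))) (fun c => by
      rw [RKHS.OfKernel.kernel_ofKernel, sum_covariance_eq hr h0 h1 hX hZ hXZ hC hCs,
        Real.sq_sqrt hnn, Real.sq_sqrt (by positivity), Real.rpow_neg hσ.le, Real.rpow_natCast]
      refine (sq_sum_smooth_le hr h0 h1 hH hh hφ hσ hB0 hB hC c).trans ?_
      have hQ : 0 ≤ ∫ ξ : E r, ‖increment c ξ‖ ^ 2 * spectralWeight r β ξ :=
        integral_nonneg fun ξ => mul_nonneg (sq_nonneg _) (spectralWeight_nonneg r β ξ)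
      gcongr
      linarith)
  refine ⟨f, hf, ?_⟩
  calc ‖f‖ ^ 2 ≤ √(K ^ 2 * √(normConstant r φ C B + 1) ^ 2 * σ ^ (-(r : ℝ))) ^ 2 := by gcongr
    _ = _ := Real.sq_sqrt hnn
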